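/- All manifolds are real, smooth, finite-dimensional, Hausdorff and second countable; Lie groups are written additively but need not be commutative. A **Lie group-groupoid** $G$ is a Lie groupoid (source and target $\alpha,\beta:G\to G_0$ surjective submersions, object map $x\mapsto 1_x$ and composition $(b,a)\mapsto b\circ a$ smooth, the latter defined when $\alpha(b)=\beta(a)$) whose arrows $G$ and objects $G_0$ are Lie groups such that the group operations are morphisms of groupoids; in particular $\alpha,\beta$ are homomorphisms and $(b\circ a)+(d\circ c)=(b+d)\circ(a+c)$ whenever both composites exist. A morphism of Lie group-groupoids is a pair $(f,f_0)$ of Lie group homomorphisms on arrows and objects that is a morphism of groupoids. It is a **covering morphism** $p:H\to G$ if for every $x\in H_0$ it restricts to a diffeomorphism from $\mathrm{St}_Hx=\alpha_H^{-1}(x)$ onto $\mathrm{St}_G\,p_0(x)=\alpha_G^{-1}(p_0(x))$. Let $G$ be a Lie group-groupoid. Let $LGGdCov(G)$ be the category whose objects are the covering morphisms $p:H\to G$ of Lie group-groupoids and whose morphisms from $p:H\to G$ to $q:K\to G$ are the morphisms $r:H\to K$ of Lie group-groupoids with $p=q\circ r$. Let $LGGdOp(G)$ be the category whose objects are the smooth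 actions of $G$ on Lie groups: a Lie group $M$, a Lie group homomorphism $w:M\to G_0$, and a smooth map $G\,{}_\alpha\!\times_w M=\{(a,x):\alpha(a)=w(x)\}\to M$, $(a,x)\mapsto {}^ax$, with $w({}^ax)=\beta(a)$, ${}^b({}^ax)={}^{b\circ a}x$, ${}^{1_{w(x)}}x=x$ and $({}^by)+({}^ax)={}^{b+a}(y+x)$ whenever these are defined; its morphisms $(M,w)\to(M',w')$ are the Lie group homomorphisms $f:M\to M'$ with $w'\circ f=w$ and $f({}^ax)={}^af(x)$. **Theorem.** For every Lie group-groupoid $G$ the categories $LGGdCov(G)$ and $LGGdOp(G)$ are equivalent. More precisely, let $\Phi:LGGdCov(G)\to LGGdOp(G)$ be the functor that sends $p:H\to G$ to the Lie group $H_0$ with $w=p_0$ and the action ${}^ax=\beta_H(\tilde a)$, where $\tilde a$ is the unique arrow of $H$ with $\alpha_H(\tilde a)=x$ and $p(\tilde a)=a$, and sends $r$ to $r_0$. Then $\Phi$ is an equivalence of categories. It has a quasi-inverse $\Gamma$ that sends an action of $G$ on $M$ via $w$ to its action Lie group-groupoid $G\ltimes M\to G$: up to an isomorphism natural in the action, the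 Lie group of objects is $M$, the manifold of arrows is $G\,{}_\alpha\!\times_wM$, the projection is $(a,x)\mapsto a$ on arrows and $w$ on objects, the source and target of $(a,x)$ are $x$ and ${}^ax$, $(b,{}^ax)\circ(a,x)=(b\circ a,x)$ and $(a,x)+(b,y)=(a+b,x+y)$. On a morphism $f$, $\Gamma$ is $(a,x)\mapsto(a,f(x))$ on arrows and $f$ on objects. Moreover, $\Phi$ restricts to an equivalence between the full subcategory of the coverings $p$ for which $p_0$ is a submersion and the full subcategory of the actions for which $w$ is a submersion. -/

import Mathlib

open CategoryTheory Set
open scoped Manifold ContDiff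

universe u

noncomputable section

namespace LieGG

/-! ### Lie groups -/

/-- A (real, finite-dimensional, smooth, Hausdorff, second countable) Lie group, written additively
as is customary for group-groupoids; it is not assumed commutative. -/
structure LieGrp : Type (u + 1) where
  carrier : Type u
  model : Type u
  [normedModel : NormedAddCommGroup model]
  [spaceModel : NormedSpace ℝ model]
  [finDim : FiniteDimensional ℝ model]
  [top : TopologicalSpace carrier]
  [t2 : T2Space carrier]
  [secondCountable : SecondCountableTopology carrier]
  [charted : ChartedSpace model carrier]
  [addGroup : AddGroup carrier]
  [lie : LieAddGroup 𝓘(ℝ, model) ∞ carrier]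

instance : CoeSort LieGrp.{u} (Type u) := ⟨LieGrp.carrier⟩

attribute [instance] LieGrp.normedModel LieGrp.spaceModel LieGrp.finDim LieGrp.top LieGrp.t2
  LieGrp.secondCountable LieGrp.charted LieGrp.addGroup LieGrp.lie

/-- The model with corners (without boundary) of a Lie group. -/
abbrev LieGrp.I (M : LieGrp.{u}) : ModelWithCorners ℝ M.model M.model := 𝓘(ℝ, M.model)

/-- Homomorphisms of Lie groups: smooth group homomorphisms. -/
abbrev LieHom (M N : LieGrp.{u}) : Type u := ContMDiffAddMonoidMorphism M.I N.I ∞ M N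

namespace LieHom

theorem ext' {M N : LieGrp.{u}} {f g : LieHom M N} (h : ∀ x, f x = g x) : f = g :=
  DFunLike.ext f g h

theorem smooth {M N : LieGrp.{u}} (f : LieHom M N) : ContMDiff M.I N.I ∞ (f : M → N) :=
  f.contMDiff_toFun

/-- The identity homomorphism. -/
def id (M : LieGrp.{u}) : LieHom M M where
  toAddMonoidHom := AddMonoidHom.id M
  contMDiff_toFun := contMDiff_id

/-- The composite `g ∘ f`. -/
def comp {M N P : LieGrp.{u}} (g : LieHom N P) (f : LieHom M N) : LieHom M P where
  toAddMonoidHom := g.toAddMonoidHom.comp f.toAddMonoidHom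
  contMDiff_toFun := g.contMDiff_toFun.comp f.contMDiff_toFun

@[simp] theorem id_apply (M : LieGrp.{u}) (x : M) : LieHom.id M x = x := rfl

@[simp] theorem comp_apply {M N P : LieGrp.{u}} (g : LieHom N P) (f : LieHom M N) (x : M) :
    g.comp f x = g (f x) := rfl

end LieHom

/-! ### Diffeomorphisms between subsets

Smoothness of a map on an embedded submanifold `S` of a manifold is expressed by `ContMDiffOn`:
a map on `S` is smooth for the submanifold structure if and only if it is `ContMDiffOn` on `S`. -/

/-- `f` restricts to a diffeomorphism from `S` onto `T` (both will be embedded submanifolds). -/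
def IsDiffeoOn {E E' H H' M N : Type*}
    [NormedAddCommGroup E] [NormedSpace ℝ E] [TopologicalSpace H]
    [NormedAddCommGroup E'] [NormedSpace ℝ E'] [TopologicalSpace H']
    [TopologicalSpace M] [ChartedSpace H M] [TopologicalSpace N] [ChartedSpace H' N]
    (I : ModelWithCorners ℝ E H) (J : ModelWithCorners ℝ E' H')
    (f : M → N) (S : Set M) (T : Set N) : Prop :=
  ContMDiffOn I J ∞ f S ∧ MapsTo f S T ∧
    ∃ g : N → M, ContMDiffOn J I ∞ g T ∧ MapsTo g T S ∧ InvOn g f S T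

/-! ### Groupoids and Lie groupoids -/

/-- A groupoid with set of arrows `A` and set of objects `O`. The composite `comp b a` (first `a`,
then `b`) is meaningful only when `src b = tgt a`; its values elsewhere are irrelevant. -/
structure GroupoidStr (A O : Type u) where
  src : A → O
  tgt : A → O
  one : O → A
  inv : A → A
  comp : A → A → A
  src_comp : ∀ {b a : A}, src b = tgt a → src (comp b a) = src a
  tgt_comp : ∀ {b a : A}, src b = tgt a → tgt (comp b a) = tgt b
  assoc : ∀ {c b a : A}, src b = tgt a → src c = tgt b → comp c (comp b a) = comp (comp c b) a
  src_one : ∀ x : O, src (one x) = x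
  tgt_one : ∀ x : O, tgt (one x) = x
  comp_one : ∀ a : A, comp a (one (src a)) = a
  one_comp : ∀ a : A, comp (one (tgt a)) a = a
  src_inv : ∀ a : A, src (inv a) = tgt a
  tgt_inv : ∀ a : A, tgt (inv a) = src a
  inv_comp : ∀ a : A, comp (inv a) a = one (src a)
  comp_inv : ∀ a : A, comp a (inv a) = one (tgt a)

/-- A groupoid whose arrows and objects form manifolds is a Lie groupoid: source and target are
surjective submersions, the object map is smooth and the composition is smooth on the submanifold
of composable pairs. -/
structure GroupoidStr.IsLie {A O : Type u} (𝒢 : GroupoidStr A O)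
    {E F : Type u} [NormedAddCommGroup E] [NormedSpace ℝ E] [NormedAddCommGroup F]
    [NormedSpace ℝ F] [TopologicalSpace A] [ChartedSpace E A] [TopologicalSpace O]
    [ChartedSpace F O] : Prop where
  src_surjective : Function.Surjective 𝒢.src
  src_submersion : Manifold.IsSubmersion 𝓘(ℝ, E) 𝓘(ℝ, F) ∞ 𝒢.src
  tgt_surjective : Function.Surjective 𝒢.tgt
  tgt_submersion : Manifold.IsSubmersion 𝓘(ℝ, E) 𝓘(ℝ, F) ∞ 𝒢.tgt
  smooth_one : ContMDiff 𝓘(ℝ, F) 𝓘(ℝ, E) ∞ 𝒢.one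
  smooth_comp : ContMDiffOn (𝓘(ℝ, E).prod 𝓘(ℝ, E)) 𝓘(ℝ, E) ∞
    (fun q : A × A => 𝒢.comp q.1 q.2) {q : A × A | 𝒢.src q.1 = 𝒢.tgt q.2}

/-! ### Lie group-groupoids -/

/-- A Lie group-groupoid: a Lie groupoid whose arrows and objects are Lie groups such that the
addition is a morphism of groupoids (`src_add`, `tgt_add`, `interchange`). That the unit and the
negation of the group are morphisms of groupoids too is a formal consequence; see
`LieGroupGroupoid.one_zero`, `LieGroupGroupoid.one_add` and `LieGroupGroupoid.neg_comp`. -/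
structure LieGroupGroupoid : Type (u + 1) where
  Arr : LieGrp.{u}
  Obj : LieGrp.{u}
  toGroupoidStr : GroupoidStr Arr Obj
  isLie : toGroupoidStr.IsLie (E := Arr.model) (F := Obj.model)
  src_add : ∀ a b : Arr, toGroupoidStr.src (a + b) = toGroupoidStr.src a + toGroupoidStr.src b
  tgt_add : ∀ a b : Arr, toGroupoidStr.tgt (a + b) = toGroupoidStr.tgt a + toGroupoidStr.tgt b
  interchange : ∀ {b a d c : Arr}, toGroupoidStr.src b = toGroupoidStr.tgt a →
    toGroupoidStr.src d = toGroupoidStr.tgt c →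
    toGroupoidStr.comp b a + toGroupoidStr.comp d c = toGroupoidStr.comp (b + d) (a + c)

namespace LieGroupGroupoid

variable (G : LieGroupGroupoid.{u})

/-- The source map `α`, as a group homomorphism. -/
def src : G.Arr →+ G.Obj := AddMonoidHom.mk' G.toGroupoidStr.src G.src_add

/-- The target map `β`, as a group homomorphism. -/
def tgt : G.Arr →+ G.Obj := AddMonoidHom.mk' G.toGroupoidStr.tgt G.tgt_add

/-- The identity arrow `1_x` at an object. -/
def one : G.Obj → G.Arr := G.toGroupoidStr.one

/-- The composition `b ∘ a` of arrows, meaningful when `src b = tgt a`. -/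
def comp : G.Arr → G.Arr → G.Arr := G.toGroupoidStr.comp

@[simp] theorem src_one (x : G.Obj) : G.src (G.one x) = x := G.toGroupoidStr.src_one x

@[simp] theorem tgt_one (x : G.Obj) : G.tgt (G.one x) = x := G.toGroupoidStr.tgt_one x

theorem src_comp {b a : G.Arr} (h : G.src b = G.tgt a) : G.src (G.comp b a) = G.src a :=
  G.toGroupoidStr.src_comp h

theorem tgt_comp {b a : G.Arr} (h : G.src b = G.tgt a) : G.tgt (G.comp b a) = G.tgt b :=
  G.toGroupoidStr.tgt_comp h

theorem comp_add {b a d c : G.Arr} (h : G.src b = G.tgt a) (h' : G.src d = G.tgt c) :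
    G.comp b a + G.comp d c = G.comp (b + d) (a + c) :=
  G.interchange h h'

/-- An idempotent loop is an identity arrow. -/
theorem eq_one_of_comp_self {a : G.Arr} (h : G.src a = G.tgt a) (ha : G.comp a a = a) :
    a = G.one (G.src a) := by
  have h1 : G.toGroupoidStr.comp (G.toGroupoidStr.inv a) (G.toGroupoidStr.comp a a)
      = G.toGroupoidStr.comp (G.toGroupoidStr.comp (G.toGroupoidStr.inv a) a) a :=
    G.toGroupoidStr.assoc h (G.toGroupoidStr.src_inv a)
  have h2 : G.toGroupoidStr.comp a a = a := ha
  have h3 : G.toGroupoidStr.src a = G.toGroupoidStr.tgt a := h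
  rw [h2, G.toGroupoidStr.inv_comp, h3, G.toGroupoidStr.one_comp, ← h3] at h1
  exact h1.symm

theorem one_add (x y : G.Obj) : G.one (x + y) = G.one x + G.one y := by
  have hs : ∀ z : G.Obj, G.comp (G.one z) (G.one z) = G.one z := fun z => by
    have := G.toGroupoidStr.comp_one (G.toGroupoidStr.one z)
    rwa [G.toGroupoidStr.src_one] at this
  have h := G.eq_one_of_comp_self (a := G.one x + G.one y) (by simp)
    (by rw [← G.comp_add (by simp) (by simp), hs, hs])
  simpa using h.symm

theorem one_zero : G.one 0 = 0 := by
  have h := G.one_add 0 0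
  rw [add_zero] at h
  exact left_eq_add.mp h

theorem neg_comp {b a : G.Arr} (h : G.src b = G.tgt a) :
    -(G.comp b a) = G.comp (-b) (-a) := by
  have h0 : G.comp 0 0 = 0 := by
    have := G.toGroupoidStr.comp_one (G.toGroupoidStr.one 0)
    rw [G.toGroupoidStr.src_one] at this
    have h1 : G.toGroupoidStr.one 0 = 0 := G.one_zero
    rwa [h1] at this
  have h2 := G.comp_add (b := b) (a := a) (d := -b) (c := -a) h (by simp [h])
  rw [add_neg_cancel, add_neg_cancel, h0] at h2
  exact neg_eq_of_add_eq_zero_right h2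

/-- A morphism of Lie group-groupoids: a pair of smooth maps on arrows and on objects, compatible
with source, target and composition and preserving the group structure. -/
@[ext]
structure Hom (H G : LieGroupGroupoid.{u}) : Type u where
  arr : LieHom H.Arr G.Arr
  obj : LieHom H.Obj G.Obj
  src_arr : ∀ a : H.Arr, G.src (arr a) = obj (H.src a)
  tgt_arr : ∀ a : H.Arr, G.tgt (arr a) = obj (H.tgt a)
  comp_arr : ∀ {b a : H.Arr}, H.src b = H.tgt a → arr (H.comp b a) = G.comp (arr b) (arr a)

instance : Category LieGroupGroupoid.{u} where
  Hom := Hom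
  id G :=
    { arr := LieHom.id G.Arr
      obj := LieHom.id G.Obj
      src_arr := fun _ => rfl
      tgt_arr := fun _ => rfl
      comp_arr := fun _ => rfl }
  comp f g :=
    { arr := g.arr.comp f.arr
      obj := g.obj.comp f.obj
      src_arr := fun a => by simp [g.src_arr, f.src_arr]
      tgt_arr := fun a => by simp [g.tgt_arr, f.tgt_arr]
      comp_arr := fun {b a} h => by
        simp only [LieHom.comp_apply]
        rw [f.comp_arr h, g.comp_arr (by rw [f.src_arr, f.tgt_arr, h])] }

@[simp] theorem id_arr (a : G.Arr) : Hom.arr (𝟙 G) a = a := rfl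

@[simp] theorem id_obj (x : G.Obj) : Hom.obj (𝟙 G) x = x := rfl

@[simp] theorem comp_arr_apply {H K L : LieGroupGroupoid.{u}} (f : H ⟶ K) (g : K ⟶ L)
    (a : H.Arr) : Hom.arr (f ≫ g) a = Hom.arr g (Hom.arr f a) := rfl

@[simp] theorem comp_obj_apply {H K L : LieGroupGroupoid.{u}} (f : H ⟶ K) (g : K ⟶ L)
    (x : H.Obj) : Hom.obj (f ≫ g) x = Hom.obj g (Hom.obj f x) := rfl

/-- The star `St x` of an object: the arrows with source `x`. -/
def star (x : G.Obj) : Set G.Arr := {a | G.src a = x}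

end LieGroupGroupoid

open LieGroupGroupoid

/-- A morphism `p : H ⟶ G` is a covering morphism if for every object `x` of `H` it restricts to a
diffeomorphism from the star of `x` onto the star of `p x`. -/
def IsCovering {H G : LieGroupGroupoid.{u}} (p : H ⟶ G) : Prop :=
  ∀ x : H.Obj, IsDiffeoOn H.Arr.I G.Arr.I (Hom.arr p) (H.star x) (G.star (Hom.obj p x))

/-! ### The category of coverings -/

/-- A covering of the Lie group-groupoid `G`: a covering morphism `proj : total ⟶ G`. -/
structure LGGdCov (G : LieGroupGroupoid.{u}) : Type (u + 1) where
  total : LieGroupGroupoid.{u}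
  proj : total ⟶ G
  isCovering : IsCovering proj

/-- A morphism of coverings: a morphism of Lie group-groupoids over `G`. -/
@[ext]
structure LGGdCov.Hom {G : LieGroupGroupoid.{u}} (P Q : LGGdCov G) : Type u where
  hom : P.total ⟶ Q.total
  w : P.proj = hom ≫ Q.proj

instance (G : LieGroupGroupoid.{u}) : Category (LGGdCov G) where
  Hom := LGGdCov.Hom
  id P := { hom := 𝟙 P.total, w := (Category.id_comp P.proj).symm }
  comp f g :=
    { hom := f.hom ≫ g.hom
      w := by rw [Category.assoc, ← g.w, ← f.w] }

/-! ### The category of actions on Lie groups -/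

/-- A smooth action of the Lie group-groupoid `G` on a Lie group `M` via a homomorphism of Lie
groups `w : M → G₀`. The value `act a x` is meaningful only when `src a = w x`; its values
elsewhere are irrelevant. -/
structure LGGdOp (G : LieGroupGroupoid.{u}) : Type (u + 1) where
  M : LieGrp.{u}
  w : LieHom M G.Obj
  act : G.Arr → M → M
  smooth_act : ContMDiffOn (G.Arr.I.prod M.I) M.I ∞ (fun q : G.Arr × M => act q.1 q.2)
    {q : G.Arr × M | G.src q.1 = w q.2}
  w_act : ∀ {a : G.Arr} {x : M}, G.src a = w x → w (act a x) = G.tgt a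
  act_act : ∀ {b a : G.Arr} {x : M}, G.src a = w x → G.src b = G.tgt a →
    act b (act a x) = act (G.comp b a) x
  one_act : ∀ x : M, act (G.one (w x)) x = x
  interchange : ∀ {b a : G.Arr} {y x : M}, G.src b = w y → G.src a = w x →
    act b y + act a x = act (b + a) (y + x)

/-- The pullback `G ×_{α,w} M` on which an action is defined. -/
def LGGdOp.pullback {G : LieGroupGroupoid.{u}} (A : LGGdOp G) : Set (G.Arr × A.M) :=
  {q | G.src q.1 = A.w q.2}

/-- A morphism of actions: a homomorphism of Lie groups over `G₀` that is equivariant. -/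
@[ext]
structure LGGdOp.Hom {G : LieGroupGroupoid.{u}} (A B : LGGdOp G) : Type u where
  hom : LieHom A.M B.M
  w_hom : ∀ x : A.M, B.w (hom x) = A.w x
  hom_act : ∀ {a : G.Arr} {x : A.M}, G.src a = A.w x → hom (A.act a x) = B.act a (hom x)

instance (G : LieGroupGroupoid.{u}) : Category (LGGdOp G) where
  Hom := LGGdOp.Hom
  id A :=
    { hom := LieHom.id A.M
      w_hom := fun _ => rfl
      hom_act := fun _ => rfl }
  comp f g :=
    { hom := g.hom.comp f.hom
      w_hom := fun x => by simp [g.w_hom, f.w_hom]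
      hom_act := fun {a x} h => by
        simp only [LieHom.comp_apply]
        rw [f.hom_act h, g.hom_act (by rw [f.w_hom, h])] }

/-! ### The restriction functor from coverings to actions -/

namespace LGGdCov

variable {G : LieGroupGroupoid.{u}} (P : LGGdCov G)

/-- The projection of a covering on arrows. -/
abbrev p : LieHom P.total.Arr G.Arr := Hom.arr P.proj

/-- The projection of a covering on objects. -/
abbrev p₀ : LieHom P.total.Obj G.Obj := Hom.obj P.proj

theorem src_p (h : P.total.Arr) : G.src (P.p h) = P.p₀ (P.total.src h) :=
  LieGroupGroupoid.Hom.src_arr P.proj h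

theorem tgt_p (h : P.total.Arr) : G.tgt (P.p h) = P.p₀ (P.total.tgt h) :=
  LieGroupGroupoid.Hom.tgt_arr P.proj h

theorem p_comp {b a : P.total.Arr} (h : P.total.src b = P.total.tgt a) :
    P.p (P.total.comp b a) = G.comp (P.p b) (P.p a) :=
  LieGroupGroupoid.Hom.comp_arr P.proj h

theorem p_injective {h k : P.total.Arr} (hs : P.total.src h = P.total.src k)
    (hp : P.p h = P.p k) : h = k := by
  obtain ⟨-, -, g, -, -, hg⟩ := P.isCovering (P.total.src k)
  have h1 := hg.1 (show h ∈ P.total.star (P.total.src k) from hs)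
  have h2 := hg.1 (show k ∈ P.total.star (P.total.src k) from rfl)
  change g (P.p h) = h at h1
  change g (P.p k) = k at h2
  rw [← h1, ← h2, hp]

theorem exists_lift {a : G.Arr} {x : P.total.Obj} (hx : G.src a = P.p₀ x) :
    ∃ h : P.total.Arr, P.total.src h = x ∧ P.p h = a := by
  obtain ⟨-, -, g, -, hm, hg⟩ := P.isCovering x
  exact ⟨g a, hm hx, hg.2 hx⟩

open Classical in
/-- The lifting function `s_p`: for `src a = p₀ x`, the unique arrow of the covering with source
`x` that lies over `a`. -/
def lift (a : G.Arr) (x : P.total.Obj) : P.total.Arr :=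
  if h : ∃ h : P.total.Arr, P.total.src h = x ∧ P.p h = a then h.choose else 0

theorem src_lift {a : G.Arr} {x : P.total.Obj} (hx : G.src a = P.p₀ x) :
    P.total.src (P.lift a x) = x := by
  have h := P.exists_lift hx
  rw [lift, dif_pos h]
  exact h.choose_spec.1

theorem p_lift {a : G.Arr} {x : P.total.Obj} (hx : G.src a = P.p₀ x) :
    P.p (P.lift a x) = a := by
  have h := P.exists_lift hx
  rw [lift, dif_pos h]
  exact h.choose_spec.2

theorem lift_unique {a : G.Arr} {x : P.total.Obj} {h : P.total.Arr}
    (hs : P.total.src h = x) (hp : P.p h = a) : P.lift a x = h := by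
  have hx : G.src a = P.p₀ x := by rw [← hp, P.src_p, hs]
  exact P.p_injective (by rw [P.src_lift hx, hs]) (by rw [P.p_lift hx, hp])

theorem p_one (x : P.total.Obj) : P.p (P.total.one x) = G.one (P.p₀ x) := by
  have hs : P.total.comp (P.total.one x) (P.total.one x) = P.total.one x := by
    have := P.total.toGroupoidStr.comp_one (P.total.toGroupoidStr.one x)
    rwa [P.total.toGroupoidStr.src_one] at this
  have h := G.eq_one_of_comp_self (a := P.p (P.total.one x))
    (by rw [P.src_p, P.tgt_p]; simp)
    (by rw [← P.p_comp (by simp), hs])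
  rwa [P.src_p, LieGroupGroupoid.src_one] at h

theorem lift_one (x : P.total.Obj) : P.lift (G.one (P.p₀ x)) x = P.total.one x :=
  P.lift_unique (by simp) (P.p_one x)

theorem lift_add {b a : G.Arr} {y x : P.total.Obj} (hy : G.src b = P.p₀ y)
    (hx : G.src a = P.p₀ x) : P.lift (b + a) (y + x) = P.lift b y + P.lift a x :=
  P.lift_unique (by rw [map_add, P.src_lift hy, P.src_lift hx])
    (by rw [map_add, P.p_lift hy, P.p_lift hx])

theorem smooth_lift : ContMDiffOn (G.Arr.I.prod P.total.Obj.I) P.total.Arr.I ∞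
    (fun q : G.Arr × P.total.Obj => P.lift q.1 q.2)
    {q : G.Arr × P.total.Obj | G.src q.1 = P.p₀ q.2} := by
  obtain ⟨-, -, g, hg, hm, hi⟩ := P.isCovering 0
  have hone : ContMDiff G.Obj.I G.Arr.I ∞ G.one := G.isLie.smooth_one
  have hone' : ContMDiff P.total.Obj.I P.total.Arr.I ∞ P.total.one := P.total.isLie.smooth_one
  have hk : ∀ q : G.Arr × P.total.Obj, G.src q.1 = P.p₀ q.2 →
      q.1 - G.one (P.p₀ q.2) ∈ G.star (Hom.obj P.proj 0) := by
    intro q hq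
    change G.src _ = _
    rw [map_sub, LieGroupGroupoid.src_one, hq, sub_self, map_zero]
  have h1 : ContMDiff (G.Arr.I.prod P.total.Obj.I) G.Arr.I ∞
      (fun q : G.Arr × P.total.Obj => q.1 - G.one (P.p₀ q.2)) :=
    contMDiff_fst.sub (hone.comp ((LieHom.smooth P.p₀).comp contMDiff_snd))
  have h2 : ContMDiffOn (G.Arr.I.prod P.total.Obj.I) P.total.Arr.I ∞
      (fun q : G.Arr × P.total.Obj => g (q.1 - G.one (P.p₀ q.2)) + P.total.one q.2)
      {q : G.Arr × P.total.Obj | G.src q.1 = P.p₀ q.2} :=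
    (hg.comp h1.contMDiffOn hk).add (hone'.comp contMDiff_snd).contMDiffOn
  refine h2.congr fun q hq => ?_
  have h3 : P.total.src (g (q.1 - G.one (P.p₀ q.2))) = 0 := hm (hk q hq)
  have h4 : P.p (g (q.1 - G.one (P.p₀ q.2))) = q.1 - G.one (P.p₀ q.2) := hi.2 (hk q hq)
  refine P.lift_unique ?_ ?_
  · rw [map_add, h3, LieGroupGroupoid.src_one, zero_add]
  · rw [map_add, h4, P.p_one, sub_add_cancel]

/-- The action of `G` on the Lie group of objects of a covering, via `p₀`: the element `a` moves
`x` to the target of the lift of `a` that starts at `x`. -/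
def restrict : LGGdOp G where
  M := P.total.Obj
  w := P.p₀
  act a x := P.total.tgt (P.lift a x)
  smooth_act := by
    have ht : ContMDiff P.total.Arr.I P.total.Obj.I ∞ P.total.tgt :=
      P.total.isLie.tgt_submersion.contMDiff
    exact ht.comp_contMDiffOn P.smooth_lift
  w_act hx := by rw [← P.tgt_p, P.p_lift hx]
  act_act {b a x} hx hb := by
    have hy : G.src b = P.p₀ (P.total.tgt (P.lift a x)) := by rw [hb, ← P.tgt_p, P.p_lift hx]
    have hc := P.src_lift hy
    rw [P.lift_unique (a := G.comp b a) (x := x)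
      (h := P.total.comp (P.lift b (P.total.tgt (P.lift a x))) (P.lift a x))
      (by rw [P.total.src_comp hc, P.src_lift hx])
      (by rw [P.p_comp hc, P.p_lift hy, P.p_lift hx]), P.total.tgt_comp hc]
  one_act x := by rw [P.lift_one, LieGroupGroupoid.tgt_one]
  interchange hy hx := by rw [P.lift_add hy hx, map_add]

end LGGdCov

/-- The functor that restricts a covering `p : H ⟶ G` to its Lie group of objects, with the action
of `G` on `H₀` via `p₀`, and a morphism of coverings to its part on objects. -/
def restriction (G : LieGroupGroupoid.{u}) : LGGdCov G ⥤ LGGdOp G where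
  obj P := P.restrict
  map {P Q} r :=
    { hom := LieGroupGroupoid.Hom.obj r.hom
      w_hom := fun x => by
        have h := r.w
        change Q.p₀ _ = P.p₀ x
        rw [LGGdCov.p₀, LGGdCov.p₀, h]
        rfl
      hom_act := fun {a x} hx => by
        have hx' : G.src a = P.p₀ x := hx
        have hp : ∀ h, Q.p (LieGroupGroupoid.Hom.arr r.hom h) = P.p h := fun h => by
          rw [LGGdCov.p, LGGdCov.p, r.w]
          rfl
        change LieGroupGroupoid.Hom.obj r.hom (P.total.tgt (P.lift a x))
          = Q.total.tgt (Q.lift a (LieGroupGroupoid.Hom.obj r.hom x))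
        rw [Q.lift_unique (h := LieGroupGroupoid.Hom.arr r.hom (P.lift a x))
          (by rw [LieGroupGroupoid.Hom.src_arr, P.src_lift hx']) (by rw [hp, P.p_lift hx']),
          LieGroupGroupoid.Hom.tgt_arr] }

/-! ### Action Lie group-groupoids -/

/-- The covering `P` of `G` is the action Lie group-groupoid `G ⋉ M ⟶ G` of the action `A` on `M`,
where the Lie group of objects of `P` is identified with `M` by `i`. That is: `i` is an isomorphism
of Lie groups, `P` is `w` on objects, and `h ↦ (p h, i (src h))` is a diffeomorphism from the arrows
of `P` onto the pullback `G ×_{α,w} M`, under which the projection is `(a, x) ↦ a`, the source is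
`(a, x) ↦ x`, the target is `(a, x) ↦ a • x`, the composition is
`(b, y) ∘ (a, x) = (b ∘ a, x)` and the addition is `(a, x) + (b, y) = (a + b, x + y)`. -/
structure IsActionGroupoid {G : LieGroupGroupoid.{u}} (A : LGGdOp G) (P : LGGdCov G)
    (i : P.total.Obj → A.M) : Prop where
  isDiffeo_obj : IsDiffeoOn P.total.Obj.I A.M.I i univ univ
  add_obj : ∀ x y, i (x + y) = i x + i y
  proj_obj : ∀ x, P.p₀ x = A.w (i x)
  isDiffeo_arr : IsDiffeoOn P.total.Arr.I (G.Arr.I.prod A.M.I)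
    (fun h : P.total.Arr => (P.p h, i (P.total.src h))) univ A.pullback
  tgt_arr : ∀ h, i (P.total.tgt h) = A.act (P.p h) (i (P.total.src h))
  comp_arr : ∀ {b a : P.total.Arr}, P.total.src b = P.total.tgt a →
    (P.p (P.total.comp b a), i (P.total.src (P.total.comp b a)))
      = (G.comp (P.p b) (P.p a), i (P.total.src a))
  add_arr : ∀ b a : P.total.Arr,
    (P.p (b + a), i (P.total.src (b + a)))
      = (P.p b + P.p a, i (P.total.src b) + i (P.total.src a))

/-- A morphism `r : P ⟶ Q` of coverings is `1 × f` on arrows, `(a, x) ↦ (a, f x)`, and `f` on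
objects, under identifications `i`, `j` of `P`, `Q` with the action Lie group-groupoids of `A`,
`B`. -/
def IsActionGroupoidMap {G : LieGroupGroupoid.{u}} {A B : LGGdOp G} (f : A ⟶ B)
    {P Q : LGGdCov G} (r : P ⟶ Q) (i : P.total.Obj → A.M) (j : Q.total.Obj → B.M) : Prop :=
  (∀ x : P.total.Obj,
    j (LieGroupGroupoid.Hom.obj (LGGdCov.Hom.hom r) x) = LGGdOp.Hom.hom f (i x)) ∧
  ∀ h : P.total.Arr,
    (Q.p (LieGroupGroupoid.Hom.arr (LGGdCov.Hom.hom r) h),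
      j (Q.total.src (LieGroupGroupoid.Hom.arr (LGGdCov.Hom.hom r) h)))
      = (P.p h, LGGdOp.Hom.hom f (i (P.total.src h)))

/-! ### The submersive variants -/

/-- The coverings whose projection on objects is a submersion. -/
def submersiveCov (G : LieGroupGroupoid.{u}) : ObjectProperty (LGGdCov G) := fun P =>
  Manifold.IsSubmersion P.total.Obj.I G.Obj.I ∞ P.p₀

/-- The actions via a homomorphism `w` that is a submersion. -/
def submersiveOp (G : LieGroupGroupoid.{u}) : ObjectProperty (LGGdOp G) := fun A =>
  Manifold.IsSubmersion A.M.I G.Obj.I ∞ A.w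

end LieGG

end

/-! A covering has unique lifts: `h ↦ (p h, src h)` is a bijection from the arrows of `H` onto the
pullback of `α` and `p₀`. It is a smooth homomorphism, and its inverse is the lifting function,
smooth by `LGGdCov.smooth_lift`. So every covering is the action groupoid of the action on its
objects (`isoActionCovering`); conversely the lift of `a` at `x` in `G ⋉ M` is `(a, x)`, which gives
the action back.

The analytic work is to make the pullback a Lie group with submersive source and target. The map
`(a, x) ↦ (a - 1_{w x}, x)` identifies it with `ker α × M`, and `ker α` has a slice chart because
`α` is a submersion; nothing is needed of `w`. Only a chart at `0` has to be built
(`LGGdOp.sliceChart`), since translations carry it to every point of the subgroup.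

The algebra rests on `comp_eq_sub_add`: interchange forces `b ∘ a = b - 1_{src b} + a`. The
composition and inversion of `G ⋉ M` can thus be defined by total, smooth expressions in the group
operations, and most groupoid laws become group identities. -/

noncomputable section

namespace LieGG

/-! ### Lie group structure on a subgroup from one slice chart at `0` -/

section LieSubgroup

variable {E H L V : Type*} [NormedAddCommGroup E] [NormedSpace ℝ E] [TopologicalSpace H]
  {I : ModelWithCorners ℝ E H} [TopologicalSpace L] [ChartedSpace H L] [AddGroup L]
  [NormedAddCommGroup V] [NormedSpace ℝ V]

/-- A smooth parametrization by an open subset of `V` of a neighbourhood of `0` in a subgroup `S`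
of a Lie group, whose inverse extends to a smooth map on an open subset of the ambient group. -/
structure SliceChart (I : ModelWithCorners ℝ E H) (S : AddSubgroup L) (V : Type*)
    [NormedAddCommGroup V] [NormedSpace ℝ V] where
  source : Set L
  target : Set V
  toFun : L → V
  invFun : V → L
  isOpen_source : IsOpen source
  isOpen_target : IsOpen target
  zero_mem : 0 ∈ source
  mapsTo : ∀ {a}, a ∈ S → a ∈ source → toFun a ∈ target
  inv_mem : ∀ {v}, v ∈ target → invFun v ∈ S
  inv_mem_source : ∀ {v}, v ∈ target → invFun v ∈ source
  left_inv : ∀ {a}, a ∈ S → a ∈ source → invFun (toFun a) = a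
  right_inv : ∀ {v}, v ∈ target → toFun (invFun v) = v
  smooth_toFun : ContMDiffOn I 𝓘(ℝ, V) ∞ toFun source
  smooth_invFun : ContMDiffOn 𝓘(ℝ, V) I ∞ invFun target

namespace SliceChart

variable [LieAddGroup I ∞ L] {S : AddSubgroup L} (c : SliceChart I S V)

include I in
theorem contMDiff_sub_const (s : L) : ContMDiff I I ∞ (fun t : L => t - s) :=
  contMDiff_id.sub contMDiff_const

include I in
theorem contMDiff_add_const (s : L) : ContMDiff I I ∞ (fun t : L => t + s) :=
  contMDiff_id.add contMDiff_const

open Classical in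
/-- The chart of the subgroup centred at `s`, a translate of the slice chart. -/
def chart (s : S) : OpenPartialHomeomorph S V where
  toFun t := c.toFun (t - s)
  -- The value `s` off the target is junk; it only makes the function total.
  invFun v := if h : v ∈ c.target then ⟨c.invFun v, c.inv_mem h⟩ + s else s
  source := {t : S | (t : L) - (s : L) ∈ c.source}
  target := c.target
  map_source' t ht := c.mapsTo (S.sub_mem t.2 s.2) ht
  map_target' v hv := by simpa [hv] using c.inv_mem_source hv
  left_inv' t ht := by
    rw [dif_pos (c.mapsTo (S.sub_mem t.2 s.2) ht)]
    ext
    simp [c.left_inv (S.sub_mem t.2 s.2) ht]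
  right_inv' v hv := by simp [hv, c.right_inv hv]
  open_source := c.isOpen_source.preimage
    ((contMDiff_sub_const (I := I) (s : L)).continuous.comp continuous_subtype_val)
  open_target := c.isOpen_target
  continuousOn_toFun := c.smooth_toFun.continuousOn.comp
    ((contMDiff_sub_const (I := I) (s : L)).continuous.comp continuous_subtype_val).continuousOn
    fun _ h => h
  continuousOn_invFun := by
    rw [Topology.IsInducing.subtypeVal.continuousOn_iff]
    refine ((contMDiff_add_const (I := I) (s : L)).continuous.comp_continuousOn
      c.smooth_invFun.continuousOn).congr fun v hv => ?_
    simp [hv]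

theorem chart_apply (s t : S) : c.chart s t = c.toFun (t - s) := rfl

theorem chart_source (s : S) : (c.chart s).source = {t : S | (t : L) - (s : L) ∈ c.source} := rfl

theorem coe_chart_symm (s : S) {v : V} (hv : v ∈ c.target) :
    (((c.chart s).symm v : S) : L) = c.invFun v + s := by
  simp [chart, hv]

theorem mem_chart_source (s : S) : s ∈ (c.chart s).source := by
  simp [chart_source, c.zero_mem]

/-- The manifold structure of a subgroup with a slice chart. -/
abbrev chartedSpace : ChartedSpace V S where
  atlas := range c.chart
  chartAt := c.chart
  mem_chart_source := c.mem_chart_source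
  chart_mem_atlas s := mem_range_self s

/-- Transition maps factor through the ambient group: `invFun` into `L`, then translations, then
`toFun`. This works because `toFun` is smooth on an open subset of `L` and not merely along `S`. -/
theorem isManifold : @IsManifold ℝ _ V _ _ V _ 𝓘(ℝ, V) ∞ S _ c.chartedSpace := by
  let := c.chartedSpace
  refine isManifold_of_contDiffOn _ _ _ ?_
  rintro _ _ ⟨s, rfl⟩ ⟨s', rfl⟩
  have hmem : ∀ v, v ∈ ((c.chart s).symm ≫ₕ c.chart s').source →
      v ∈ c.target ∧ c.invFun v + s - s' ∈ c.source := by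
    intro v hv
    have h1 : v ∈ c.target := hv.1
    have h2 : (((c.chart s).symm v : S) : L) - s' ∈ c.source := hv.2
    rw [c.coe_chart_symm s h1] at h2
    exact ⟨h1, h2⟩
  rw [← contMDiffOn_iff_contDiffOn]
  have h : ContMDiffOn 𝓘(ℝ, V) 𝓘(ℝ, V) ∞ (fun v => c.toFun (c.invFun v + s - s'))
      ((c.chart s).symm ≫ₕ c.chart s').source :=
    c.smooth_toFun.comp (((contMDiff_sub_const (I := I) (s' : L)).comp
      (contMDiff_add_const (I := I) (s : L))).comp_contMDiffOn
        (c.smooth_invFun.mono fun v hv => (hmem v hv).1)) fun v hv => (hmem v hv).2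
  have hs : (𝓘(ℝ, V).symm ⁻¹' ((c.chart s).symm ≫ₕ c.chart s').source ∩ range 𝓘(ℝ, V))
      = ((c.chart s).symm ≫ₕ c.chart s').source := by simp
  rw [hs]
  refine h.congr fun v hv => ?_
  change c.toFun (((c.chart s).symm v : S) - s') = _
  rw [c.coe_chart_symm s (hmem v hv).1]

theorem contMDiff_val : @ContMDiff ℝ _ V _ _ V _ 𝓘(ℝ, V) S _ c.chartedSpace E _ _ H _ I L _ _ ∞
    (Subtype.val : S → L) := by
  let := c.chartedSpace
  have := c.isManifold
  intro s
  have h1 : ContMDiffAt 𝓘(ℝ, V) 𝓘(ℝ, V) ∞ (c.chart s) s :=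
    contMDiffAt_of_mem_maximalAtlas (IsManifold.chart_mem_maximalAtlas (n := ∞) s)
      (c.mem_chart_source s)
  have hm : c.chart s s ∈ c.target := (c.chart s).map_source (c.mem_chart_source s)
  -- On the chart domain the inclusion equals this smooth expression.
  have h2 : ContMDiffAt 𝓘(ℝ, V) I ∞ (fun t : S => c.invFun (c.chart s t) + s) s :=
    (contMDiff_add_const (I := I) (s : L)).contMDiffAt.comp s
      ((c.smooth_invFun.contMDiffAt (c.isOpen_target.mem_nhds hm)).comp s h1)
  refine h2.congr_of_eventuallyEq ?_
  filter_upwards [(c.chart s).open_source.mem_nhds (c.mem_chart_source s)] with t ht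
  rw [chart_apply, c.left_inv (S.sub_mem t.2 s.2) ht, sub_add_cancel]

variable {E' H' X : Type*} [NormedAddCommGroup E'] [NormedSpace ℝ E'] [TopologicalSpace H']
  {J : ModelWithCorners ℝ E' H'} [TopologicalSpace X] [ChartedSpace H' X]

/-- A map into the subgroup is smooth if it is smooth as a map into the ambient group. -/
theorem contMDiffOn_of_val {f : X → S} {A : Set X}
    (hf : ContMDiffOn J I ∞ (fun x => (f x : L)) A) :
    @ContMDiffOn ℝ _ E' _ _ H' _ J X _ _ V _ _ V _ 𝓘(ℝ, V) S _ c.chartedSpace ∞ f A := by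
  let := c.chartedSpace
  intro x hx
  rw [contMDiffWithinAt_iff_target]
  refine ⟨Topology.IsInducing.subtypeVal.continuousWithinAt_iff.2
    (hf x hx).continuousWithinAt, ?_⟩
  -- In the chart centred at `f x`, the map reads `y ↦ c.toFun (f y - f x)`, a composite of maps
  -- that are smooth on the ambient group.
  have h1 : ContMDiffWithinAt J I ∞ (fun y => (f y : L) - f x) A x :=
    (contMDiff_sub_const (I := I) (f x : L)).contMDiffAt.comp_contMDiffWithinAt x (hf x hx)
  have h2 : ContMDiffAt I 𝓘(ℝ, V) ∞ c.toFun ((f x : L) - f x) :=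
    c.smooth_toFun.contMDiffAt (c.isOpen_source.mem_nhds (by simpa using c.zero_mem))
  exact ContMDiffAt.comp_contMDiffWithinAt (f := fun y => (f y : L) - f x) x h2 h1

theorem contMDiff_of_val {f : X → S} (hf : ContMDiff J I ∞ (fun x => (f x : L))) :
    @ContMDiff ℝ _ E' _ _ H' _ J X _ _ V _ _ V _ 𝓘(ℝ, V) S _ c.chartedSpace ∞ f := by
  let := c.chartedSpace
  rw [← contMDiffOn_univ]
  exact c.contMDiffOn_of_val hf.contMDiffOn

/-- The inclusion is smooth and smoothness into `S` is tested in `L`, so both operations inherit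
smoothness from `L`. -/
theorem lieAddGroup : @LieAddGroup ℝ _ V _ V _ _ 𝓘(ℝ, V) ∞ S _ _ c.chartedSpace := by
  let := c.chartedSpace
  have := c.isManifold
  exact
    { contMDiff_add := c.contMDiff_of_val
        ((c.contMDiff_val.comp contMDiff_fst).add (c.contMDiff_val.comp contMDiff_snd))
      contMDiff_neg := c.contMDiff_of_val c.contMDiff_val.neg }

end SliceChart

end LieSubgroup

section LieGrpOfSliceChart

variable {E H : Type*} {L V : Type u} [NormedAddCommGroup E] [NormedSpace ℝ E]
  [TopologicalSpace H] {I : ModelWithCorners ℝ E H} [TopologicalSpace L] [ChartedSpace H L]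
  [AddGroup L] [NormedAddCommGroup V] [NormedSpace ℝ V] [LieAddGroup I ∞ L]
  [T2Space L] [SecondCountableTopology L] [FiniteDimensional ℝ V]

/-- A subgroup with a slice chart, as a Lie group. -/
def SliceChart.toLieGrp {S : AddSubgroup L} (c : SliceChart I S V) : LieGrp.{u} where
  carrier := S
  model := V
  secondCountable := TopologicalSpace.Subtype.secondCountableTopology (S : Set L)
  charted := c.chartedSpace
  lie := c.lieAddGroup

end LieGrpOfSliceChart

/-! ### Submersions under diffeomorphisms and translations -/

section Submersion

open Manifold

variable {E E' F H H' X Y : Type*} [NormedAddCommGroup E] [NormedSpace ℝ E]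
  [NormedAddCommGroup E'] [NormedSpace ℝ E'] [NormedAddCommGroup F] [NormedSpace ℝ F]
  [TopologicalSpace H] [TopologicalSpace H'] {I : ModelWithCorners ℝ E H}
  {J : ModelWithCorners ℝ E' H'} [TopologicalSpace X] [ChartedSpace H X]
  [TopologicalSpace Y] [ChartedSpace H' Y]

/-- Allows the charts of a submersion's local normal form to be moved along a diffeomorphism without
leaving the maximal atlas. -/
theorem diffeomorph_trans_mem_maximalAtlas [IsManifold I ∞ X] (φ : X ≃ₘ^∞⟮I, I⟯ X)
    {e : OpenPartialHomeomorph X H} (he : e ∈ IsManifold.maximalAtlas I ∞ X) :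
    φ.toHomeomorph.transOpenPartialHomeomorph e ∈ IsManifold.maximalAtlas I ∞ X := by
  refine OpenPartialHomeomorph.mem_maximalAtlas_of_contMDiffOn (I := I) (n := ∞) _ ?_ ?_
  · exact (contMDiffOn_of_mem_maximalAtlas he).comp φ.contMDiff.contMDiffOn fun _ h => h
  · exact φ.symm.contMDiff.comp_contMDiffOn (contMDiffOn_symm_of_mem_maximalAtlas he)

/-- The composite of a submersion with a diffeomorphism of the source is a submersion. -/
theorem isSubmersionAtOfComplement_comp_diffeomorph [IsManifold I ∞ X] {f : X → Y}
    (φ : X ≃ₘ^∞⟮I, I⟯ X) {x : X} (hf : IsSubmersionAtOfComplement F I J ∞ f (φ x)) :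
    IsSubmersionAtOfComplement F I J ∞ (f ∘ φ) x := by
  -- The diffeomorphism is absorbed into the domain chart, so the normal form in coordinates does
  -- not change.
  refine .mk_of_charts hf.equiv (φ.toHomeomorph.transOpenPartialHomeomorph hf.domChart)
    hf.codChart hf.mem_domChart_source hf.mem_codChart_source
    (diffeomorph_trans_mem_maximalAtlas φ hf.domChart_mem_maximalAtlas)
    hf.codChart_mem_maximalAtlas (fun y hy => hf.source_subset_preimage_source hy) ?_
  intro y hy
  rw [← hf.writtenInCharts (show y ∈ (hf.domChart.extend I).target by simpa using hy)]
  simp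

/-- The composite of a submersion with a diffeomorphism of the target is a submersion. -/
theorem isSubmersionAtOfComplement_diffeomorph_comp [IsManifold J ∞ Y] {f : X → Y}
    (ψ : Y ≃ₘ^∞⟮J, J⟯ Y) {x : X} (hf : IsSubmersionAtOfComplement F I J ∞ f x) :
    IsSubmersionAtOfComplement F I J ∞ (ψ ∘ f) x := by
  refine .mk_of_charts hf.equiv hf.domChart
    (ψ.symm.toHomeomorph.transOpenPartialHomeomorph hf.codChart) hf.mem_domChart_source
    (by simpa using hf.mem_codChart_source) hf.domChart_mem_maximalAtlas
    (diffeomorph_trans_mem_maximalAtlas ψ.symm hf.codChart_mem_maximalAtlas)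
    (fun y hy => by simpa using hf.source_subset_preimage_source hy) ?_
  intro y hy
  rw [← hf.writtenInCharts hy]
  simp

end Submersion

/-- The right translation of a Lie group by `s`, as a diffeomorphism. -/
def LieGrp.translate (M : LieGrp.{u}) (s : M) : M ≃ₘ^∞⟮M.I, M.I⟯ M where
  toEquiv := Equiv.addRight s
  contMDiff_toFun := contMDiff_id.add contMDiff_const
  contMDiff_invFun := contMDiff_id.add contMDiff_const

theorem LieGrp.translate_apply (M : LieGrp.{u}) (s x : M) : M.translate s x = x + s := rfl

open Manifold in
/-- A homomorphism of Lie groups that is a submersion at `0` is a submersion. -/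
theorem isSubmersion_of_isSubmersionAtOfComplement_zero {M N : LieGrp.{u}} {F : Type u}
    [NormedAddCommGroup F] [NormedSpace ℝ F] (f : M →+ N)
    (hf : IsSubmersionAtOfComplement F M.I N.I ∞ f 0) : IsSubmersion M.I N.I ∞ f := by
  -- A global submersion needs one complement for all points; translation keeps `F`. At `s`, the map
  -- `f` is translation by `-s`, then `f`, then translation by `f s`.
  refine IsSubmersionOfComplement.isSubmersion (F := F) fun s => ?_
  have h1 := isSubmersionAtOfComplement_comp_diffeomorph (M.translate (-s)) (x := s) (f := f)
    (by rwa [LieGrp.translate_apply, add_neg_cancel])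
  have h2 := isSubmersionAtOfComplement_diffeomorph_comp (N.translate (f s)) h1
  convert h2 using 1
  ext x
  simp [LieGrp.translate_apply]

/-! ### The kernel of a submersive homomorphism -/

section Kernel

open Manifold

variable {A B : LieGrp.{u}} {F : Type u} [NormedAddCommGroup F] [NormedSpace ℝ F] {f : A →+ B}

theorem codChart_apply_of_isSubmersionAt (h : IsSubmersionAtOfComplement F A.I B.I ∞ f 0)
    {y : A.model} (hy : y ∈ h.domChart.target) :
    h.codChart (f (h.domChart.symm y)) = (h.equiv y).1 := by
  simpa using h.writtenInCharts (show y ∈ (h.domChart.extend A.I).target by simpa using hy)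

/-- In the normal form `f` is the first coordinate. On the kernel that coordinate is frozen at
`h.codChart 0`, so the second one alone recovers the point. -/
theorem equiv_domChart_of_mem_ker (h : IsSubmersionAtOfComplement F A.I B.I ∞ f 0) {a : A}
    (ha : a ∈ f.ker) (hs : a ∈ h.domChart.source) :
    h.equiv.symm (h.codChart 0, (h.equiv (h.domChart a)).2) = h.domChart a := by
  have h1 := codChart_apply_of_isSubmersionAt h (h.domChart.map_source hs)
  rw [h.domChart.left_inv hs, (AddMonoidHom.mem_ker).1 ha] at h1
  rw [h1, Prod.mk.eta, ContinuousLinearEquiv.symm_apply_apply]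

/-- The slice chart of the kernel of a submersive homomorphism of Lie groups. -/
def kerSliceChart (h : IsSubmersionAtOfComplement F A.I B.I ∞ f 0) :
    SliceChart A.I f.ker F where
  source := h.domChart.source
  target := {v | h.equiv.symm (h.codChart 0, v) ∈ h.domChart.target}
  toFun a := (h.equiv (h.domChart a)).2
  invFun v := h.domChart.symm (h.equiv.symm (h.codChart 0, v))
  isOpen_source := h.domChart.open_source
  isOpen_target := h.domChart.open_target.preimage (by fun_prop)
  zero_mem := h.mem_domChart_source
  mapsTo ha hs := by
    rw [mem_ofPred_eq, equiv_domChart_of_mem_ker h ha hs]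
    exact h.domChart.map_source hs
  inv_mem {v} hv := by
    have h1 := codChart_apply_of_isSubmersionAt h hv
    rw [ContinuousLinearEquiv.apply_symm_apply] at h1
    -- The value of `f` has the same coordinates as `0`, and `codChart` is injective on its source.
    refine AddMonoidHom.mem_ker.2 (h.codChart.injOn
      (h.source_subset_preimage_source (h.domChart.map_target hv)) ?_ h1)
    simpa using h.mem_codChart_source
  inv_mem_source hv := h.domChart.map_target hv
  left_inv ha hs := by rw [equiv_domChart_of_mem_ker h ha hs, h.domChart.left_inv hs]
  right_inv hv := by rw [h.domChart.right_inv hv, ContinuousLinearEquiv.apply_symm_apply]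
  smooth_toFun := by
    have h1 : ContMDiff 𝓘(ℝ, A.model) 𝓘(ℝ, F) ∞ (fun y => (h.equiv y).2) := by
      rw [contMDiff_iff_contDiff]; fun_prop
    exact h1.comp_contMDiffOn (contMDiffOn_of_mem_maximalAtlas h.domChart_mem_maximalAtlas)
  smooth_invFun := by
    have h1 : ContMDiff 𝓘(ℝ, F) 𝓘(ℝ, A.model) ∞
        (fun v => h.equiv.symm (h.codChart 0, v)) := by
      rw [contMDiff_iff_contDiff]; fun_prop
    exact (contMDiffOn_symm_of_mem_maximalAtlas h.domChart_mem_maximalAtlas).comp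
      h1.contMDiffOn fun _ hv => hv

/-- The complement is a quotient of the model of `A`. Finite dimension is required of the model of a
`LieGrp`. -/
theorem finiteDimensional_of_isSubmersionAt (h : IsSubmersionAtOfComplement F A.I B.I ∞ f 0) :
    FiniteDimensional ℝ F :=
  Module.Finite.of_surjective ((LinearMap.snd ℝ B.model F).comp h.equiv.toLinearMap)
    (Prod.snd_surjective.comp h.equiv.surjective)

end Kernel

/-! ### Stars and composition in a Lie group-groupoid -/

namespace LieGroupGroupoid

variable (G : LieGroupGroupoid.{u})

/-- The model space of the stars of a Lie group-groupoid. -/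
abbrev StarModel : Type u := G.isLie.src_submersion.complement

theorem isSubmersionAt_src_zero :
    Manifold.IsSubmersionAtOfComplement G.StarModel G.Arr.I G.Obj.I ∞ G.src 0 :=
  G.isLie.src_submersion.isSubmersionOfComplement_complement 0

instance : FiniteDimensional ℝ G.StarModel :=
  finiteDimensional_of_isSubmersionAt G.isSubmersionAt_src_zero

theorem smooth_src : ContMDiff G.Arr.I G.Obj.I ∞ G.src := G.isLie.src_submersion.contMDiff

theorem smooth_one : ContMDiff G.Obj.I G.Arr.I ∞ G.one := G.isLie.smooth_one

theorem comp_one_src (a : G.Arr) : G.comp a (G.one (G.src a)) = a :=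
  G.toGroupoidStr.comp_one a

theorem one_tgt_comp (a : G.Arr) : G.comp (G.one (G.tgt a)) a = a :=
  G.toGroupoidStr.one_comp a

/-- The composition of a group-groupoid is determined by the addition. -/
theorem comp_eq_sub_add {b a : G.Arr} (h : G.src b = G.tgt a) :
    G.comp b a = b - G.one (G.src b) + a := by
  -- Interchange is applied to `b = (b - 1) + 1` and `a = 0 + a`, with `1` the identity at `src b`;
  -- the arrow `0` is the identity at the object `0`.
  have h1 : G.comp (b - G.one (G.src b)) 0 = b - G.one (G.src b) := by
    simpa [G.one_zero] using G.comp_one_src (b - G.one (G.src b))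
  have h2 : G.comp (G.one (G.src b)) a = a := by rw [h, G.one_tgt_comp]
  have h3 := G.comp_add (b := b - G.one (G.src b)) (a := 0) (d := G.one (G.src b)) (c := a)
    (by simp) (by simp [h])
  rwa [h1, h2, sub_add_cancel, zero_add, eq_comm] at h3

end LieGroupGroupoid

/-! ### The pullback as a Lie group -/

namespace LGGdOp

variable {G : LieGroupGroupoid.{u}} (A : LGGdOp G)

/-- The pullback `G ×_{α,w} M` as a subgroup. -/
def pullbackSubgroup : AddSubgroup (G.Arr × A.M) where
  carrier := A.pullback
  zero_mem' := by simp [pullback]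
  add_mem' {p q} hp hq := by
    have hp' : G.src p.1 = A.w p.2 := hp
    have hq' : G.src q.1 = A.w q.2 := hq
    simp [pullback, hp', hq']
  neg_mem' {p} hp := by
    have hp' : G.src p.1 = A.w p.2 := hp
    simp [pullback, hp']

theorem mem_pullbackSubgroup {q : G.Arr × A.M} :
    q ∈ A.pullbackSubgroup ↔ G.src q.1 = A.w q.2 := Iff.rfl

/-- The displacement of a pair from the unit section. -/
def displacement (q : G.Arr × A.M) : G.Arr := q.1 - G.one (A.w q.2)

theorem smooth_displacement : ContMDiff (G.Arr.I.prod A.M.I) G.Arr.I ∞ A.displacement :=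
  contMDiff_fst.sub (G.smooth_one.comp (A.w.smooth.comp contMDiff_snd))

/-- Subtracting `1_{w x}` translates the star of `w x` to the star of `0`, which is the kernel of
the source. -/
theorem displacement_mem_ker {q : G.Arr × A.M} (hq : q ∈ A.pullbackSubgroup) :
    A.displacement q ∈ G.src.ker := by
  rw [AddMonoidHom.mem_ker, displacement, map_sub, G.src_one, A.mem_pullbackSubgroup.1 hq, sub_self]

/-- The slice chart of the pullback given by a slice chart of the star of `0` and the chart of `M`
at `0`. -/
def sliceChart :
    SliceChart (G.Arr.I.prod A.M.I) A.pullbackSubgroup (G.StarModel × A.M.model) :=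
  let c := kerSliceChart G.isSubmersionAt_src_zero
  let φ : OpenPartialHomeomorph A.M A.M.model := chartAt A.M.model (0 : A.M)
  have hsymm : ContMDiffOn 𝓘(ℝ, G.StarModel × A.M.model) A.M.I ∞
      (fun v : G.StarModel × A.M.model => φ.symm v.2) (c.target ×ˢ φ.target) :=
    (contMDiffOn_chart_symm (I := A.M.I) (n := ∞) (x := (0 : A.M))).comp
      (contMDiff_iff_contDiff.2 contDiff_snd).contMDiffOn fun _ hv => hv.2
  { source := {q | A.displacement q ∈ c.source ∧ q.2 ∈ φ.source}
    target := c.target ×ˢ φ.target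
    -- Coordinates come from the splitting `(a, x) ↦ (a - 1_{w x}, x)` onto `ker α × M`, with
    -- inverse `(k, x) ↦ (k + 1_{w x}, x)`.
    toFun := fun q => (c.toFun (A.displacement q), φ q.2)
    invFun := fun v => (c.invFun v.1 + G.one (A.w (φ.symm v.2)), φ.symm v.2)
    isOpen_source := (c.isOpen_source.preimage A.smooth_displacement.continuous).inter
      (φ.open_source.preimage continuous_snd)
    isOpen_target := c.isOpen_target.prod φ.open_target
    zero_mem := ⟨by simpa [displacement, G.one_zero] using c.zero_mem, mem_chart_source _ _⟩
    mapsTo := fun hq hs => ⟨c.mapsTo (A.displacement_mem_ker hq) hs.1, φ.map_source hs.2⟩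
    inv_mem := fun {v} hv => by
      have h1 : G.src (c.invFun v.1) = 0 := c.inv_mem hv.1
      rw [mem_pullbackSubgroup, map_add, h1, G.src_one, zero_add]
    inv_mem_source := fun {v} hv => by
      refine ⟨?_, φ.map_target hv.2⟩
      simpa [displacement] using c.inv_mem_source hv.1
    left_inv := fun {q} hq hs => by
      ext
      · simp only [c.left_inv (A.displacement_mem_ker hq) hs.1, φ.left_inv hs.2]
        simp [displacement]
      · exact φ.left_inv hs.2
    right_inv := fun {v} hv => by
      ext
      · simp [displacement, c.right_inv hv.1]
      · exact φ.right_inv hv.2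
    smooth_toFun := by
      have h1 : ContMDiffOn (G.Arr.I.prod A.M.I) 𝓘(ℝ, G.StarModel) ∞
          (fun q => c.toFun (A.displacement q))
          {q | A.displacement q ∈ c.source ∧ q.2 ∈ φ.source} :=
        c.smooth_toFun.comp A.smooth_displacement.contMDiffOn fun _ h => h.1
      have h2 : ContMDiffOn (G.Arr.I.prod A.M.I) 𝓘(ℝ, A.M.model) ∞
          (fun q : G.Arr × A.M => φ q.2)
          {q | A.displacement q ∈ c.source ∧ q.2 ∈ φ.source} :=
        (contMDiffOn_chart (I := A.M.I) (n := ∞) (x := (0 : A.M))).comp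
          contMDiff_snd.contMDiffOn fun _ h => h.2
      exact h1.prodMk_space h2
    smooth_invFun := by
      have h1 : ContMDiffOn 𝓘(ℝ, G.StarModel × A.M.model) G.Arr.I ∞
          (fun v : G.StarModel × A.M.model => c.invFun v.1) (c.target ×ˢ φ.target) :=
        c.smooth_invFun.comp (contMDiff_iff_contDiff.2 contDiff_fst).contMDiffOn fun _ hv => hv.1
      exact (h1.add ((G.smooth_one.comp A.w.smooth).comp_contMDiffOn hsymm)).prodMk hsymm }

/-- The pullback `G ×_{α,w} M` as a Lie group. -/
def arrows : LieGrp.{u} := A.sliceChart.toLieGrp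

namespace arrows

/-- The projection `(a, x) ↦ a` of the pullback. -/
def fst : LieHom A.arrows G.Arr where
  toAddMonoidHom := (AddMonoidHom.fst G.Arr A.M).comp A.pullbackSubgroup.subtype
  contMDiff_toFun := contMDiff_fst.comp A.sliceChart.contMDiff_val

/-- The projection `(a, x) ↦ x` of the pullback. -/
def snd : LieHom A.arrows A.M where
  toAddMonoidHom := (AddMonoidHom.snd G.Arr A.M).comp A.pullbackSubgroup.subtype
  contMDiff_toFun := contMDiff_snd.comp A.sliceChart.contMDiff_val

variable {A}

theorem src_fst (q : A.arrows) : G.src (fst A q) = A.w (snd A q) := Subtype.property q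

/-- The element `(a, x)` of the pullback. -/
def mk (a : G.Arr) (x : A.M) (h : G.src a = A.w x) : A.arrows := (⟨(a, x), h⟩ : A.pullbackSubgroup)

@[simp] theorem fst_mk (a : G.Arr) (x : A.M) (h : G.src a = A.w x) : fst A (mk a x h) = a := rfl

@[simp] theorem snd_mk (a : G.Arr) (x : A.M) (h : G.src a = A.w x) : snd A (mk a x h) = x := rfl

theorem ext {p q : A.arrows} (h1 : fst A p = fst A q) (h2 : snd A p = snd A q) : p = q :=
  Subtype.ext (Prod.ext h1 h2)

variable {E H X : Type*} [NormedAddCommGroup E] [NormedSpace ℝ E] [TopologicalSpace H]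
  {J : ModelWithCorners ℝ E H} [TopologicalSpace X] [ChartedSpace H X]

theorem contMDiffOn {f : X → A.arrows} {s : Set X}
    (h1 : ContMDiffOn J G.Arr.I ∞ (fun x => fst A (f x)) s)
    (h2 : ContMDiffOn J A.M.I ∞ (fun x => snd A (f x)) s) :
    ContMDiffOn J A.arrows.I ∞ f s :=
  A.sliceChart.contMDiffOn_of_val (h1.prodMk h2)

theorem contMDiff {f : X → A.arrows}
    (h1 : ContMDiff J G.Arr.I ∞ (fun x => fst A (f x)))
    (h2 : ContMDiff J A.M.I ∞ (fun x => snd A (f x))) :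
    ContMDiff J A.arrows.I ∞ f :=
  A.sliceChart.contMDiff_of_val (h1.prodMk h2)

/-- The projection of the pullback to `M` is a submersion. -/
theorem isSubmersion_snd : Manifold.IsSubmersion A.arrows.I A.M.I ∞ (snd A) := by
  refine isSubmersion_of_isSubmersionAtOfComplement_zero (F := G.StarModel)
    (snd A).toAddMonoidHom ?_
  let φ : OpenPartialHomeomorph A.M A.M.model := chartAt A.M.model (0 : A.M)
  -- In the slice chart the map is the projection to the second factor; the swap matches the normal
  -- form, which projects to the first.
  refine .mk_of_charts (ContinuousLinearEquiv.prodComm ℝ G.StarModel A.M.model)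
    (chartAt A.arrows.model (0 : A.arrows)) φ (mem_chart_source _ _) ?_
    (IsManifold.chart_mem_maximalAtlas _) (IsManifold.chart_mem_maximalAtlas _) ?_ ?_
  · rw [map_zero]
    exact mem_chart_source _ _
  · intro q hq
    -- The chart at `0` is the slice chart translated by `0`, hence the `- 0`.
    have h : snd A (q - 0) ∈ φ.source := hq.2
    rwa [sub_zero] at h
  · intro v hv
    have hv' : v ∈ (chartAt A.arrows.model (0 : A.arrows)).target := by simpa using hv
    have h := (chartAt A.arrows.model (0 : A.arrows)).right_inv hv'
    have h' : φ (snd A ((chartAt A.arrows.model (0 : A.arrows)).symm v - 0)) = v.2 :=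
      congrArg Prod.snd h
    rw [sub_zero] at h'
    exact h'

end arrows

end LGGdOp

/-! ### The action Lie group-groupoid and its functoriality -/

namespace LGGdOp

variable {G : LieGroupGroupoid.{u}} (A : LGGdOp G)

namespace arrows

/-- The unit section `x ↦ (1_{w x}, x)`. -/
def unit : LieHom A.M A.arrows where
  toFun x := mk (G.one (A.w x)) x (G.src_one _)
  map_zero' := ext (by simp [G.one_zero]) (by simp)
  map_add' x y := ext (by simp [G.one_add]) (by simp)
  contMDiff_toFun := arrows.contMDiff (G.smooth_one.comp A.w.smooth) contMDiff_id

@[simp] theorem fst_unit (x : A.M) : fst A (unit A x) = G.one (A.w x) := rfl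

@[simp] theorem snd_unit (x : A.M) : snd A (unit A x) = x := rfl

/-- The target `(a, x) ↦ a • x` of the action groupoid. -/
def target : LieHom A.arrows A.M where
  toAddMonoidHom := AddMonoidHom.mk' (fun q => A.act (fst A q) (snd A q)) fun p q => by
    -- Additivity of the target is exactly the interchange law of the action.
    rw [A.interchange (src_fst p) (src_fst q), map_add, map_add]
  contMDiff_toFun := A.smooth_act.comp_contMDiff
    ((fst A).smooth.prodMk (snd A).smooth) src_fst

theorem target_apply (q : A.arrows) : target A q = A.act (fst A q) (snd A q) := rfl

@[simp] theorem target_unit (x : A.M) : target A (unit A x) = x := A.one_act x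

variable {A}

theorem w_target (q : A.arrows) : A.w (target A q) = G.tgt (fst A q) := A.w_act (src_fst q)

theorem src_fst_eq_tgt_fst {q p : A.arrows} (h : snd A q = target A p) :
    G.src (fst A q) = G.tgt (fst A p) := by
  rw [src_fst, h, w_target]

/-- The composition `(b, y) ∘ (a, x) = (b ∘ a, x)`, written in terms of the addition. -/
def comp (q p : A.arrows) : A.arrows := q - unit A (snd A q) + p

/-- Links the additive formula, which makes sense for all pairs, to the composition of `G`; the two
agree by `comp_eq_sub_add`. -/
theorem fst_comp {q p : A.arrows} (h : snd A q = target A p) :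
    fst A (comp q p) = G.comp (fst A q) (fst A p) := by
  rw [G.comp_eq_sub_add (src_fst_eq_tgt_fst h), src_fst]
  simp [comp]

@[simp] theorem snd_comp (q p : A.arrows) : snd A (comp q p) = snd A p := by
  simp [comp]

theorem target_comp {q p : A.arrows} (h : snd A q = target A p) :
    target A (comp q p) = target A q := by
  rw [target_apply, fst_comp h, snd_comp, ← A.act_act (src_fst p) (src_fst_eq_tgt_fst h),
    ← target_apply A p, ← h, ← target_apply]

/-- The inverse `(a, x) ↦ (a⁻¹, a • x)`, written in terms of the addition. -/
def inv (q : A.arrows) : A.arrows := unit A (snd A q) - q + unit A (target A q)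

@[simp] theorem snd_inv (q : A.arrows) : snd A (inv q) = target A q := by
  simp [inv]

@[simp] theorem target_inv (q : A.arrows) : target A (inv q) = snd A q := by
  simp [inv]

theorem inv_comp (q : A.arrows) : comp (inv q) q = unit A (snd A q) := by
  rw [comp, snd_inv, inv]
  simp

theorem comp_inv (q : A.arrows) : comp q (inv q) = unit A (target A q) := by
  simp [comp, inv, sub_eq_add_neg, add_assoc]

theorem inv_inv (q : A.arrows) : inv (inv q) = q := by
  rw [inv, snd_inv, target_inv, inv]
  simp [sub_eq_add_neg, add_assoc]

theorem contMDiff_inv : ContMDiff A.arrows.I A.arrows.I ∞ (inv : A.arrows → A.arrows) :=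
  (((unit A).smooth.comp (snd A).smooth).sub contMDiff_id).add
    ((unit A).smooth.comp (target A).smooth)

/-- The inversion of the action groupoid, as a diffeomorphism. -/
def invDiffeomorph : A.arrows ≃ₘ^∞⟮A.arrows.I, A.arrows.I⟯ A.arrows where
  toFun := inv
  invFun := inv
  left_inv := inv_inv
  right_inv := inv_inv
  contMDiff_toFun := contMDiff_inv
  contMDiff_invFun := contMDiff_inv

/-- The target is the source precomposed with the inversion, which is a diffeomorphism. -/
theorem isSubmersion_target : Manifold.IsSubmersion A.arrows.I A.M.I ∞ (target A) := by
  obtain ⟨F, hN, hS, hF⟩ := isSubmersion_snd (A := A)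
  refine ⟨F, hN, hS, fun q => ?_⟩
  have h := isSubmersionAtOfComplement_comp_diffeomorph (invDiffeomorph (A := A)) (hF (inv q))
  convert h using 1
  ext p
  exact (snd_inv p).symm

-- This is the covering condition for `G ⋉ M ⟶ G`: the inverse on a star is `a ↦ (a, x)`, smooth
-- because both coordinates are.
open Classical in
theorem isDiffeoOn_fst (x : A.M) :
    IsDiffeoOn A.arrows.I G.Arr.I (fst A) {q | snd A q = x} {a | G.src a = A.w x} := by
  let g : G.Arr → A.arrows := fun a => if h : G.src a = A.w x then mk a x h else 0
  have hg : ∀ {a} (h : G.src a = A.w x), g a = mk a x h := fun h => dif_pos h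
  have hfst : ∀ {q}, snd A q = x → G.src (fst A q) = A.w x := fun {q} h => by rw [src_fst, h]
  refine ⟨(fst A).smooth.contMDiffOn, fun q hq => hfst hq, g, ?_, fun a ha => ?_,
    fun q hq => ?_, fun a ha => ?_⟩
  · refine arrows.contMDiffOn (contMDiffOn_id.congr fun a ha => ?_)
      ((contMDiffOn_const (c := x)).congr fun a ha => ?_)
    · rw [hg ha, fst_mk, id]
    · rw [hg ha, snd_mk]
  · rw [hg ha]
    exact snd_mk _ _ _
  · rw [hg (hfst hq)]
    exact ext rfl (Eq.symm hq)
  · rw [hg ha, fst_mk]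

end arrows

open arrows

/-- The action groupoid of `A`. -/
def groupoidStr : GroupoidStr A.arrows A.M where
  src := snd A
  tgt := target A
  one := unit A
  inv := inv
  comp := comp
  src_comp _ := snd_comp _ _
  tgt_comp h := target_comp h
  assoc {c b a} h h' := by
    simp [comp, sub_eq_add_neg, add_assoc]
  src_one := snd_unit A
  tgt_one := target_unit A
  comp_one a := by simp [comp]
  one_comp a := by simp [comp]
  src_inv := snd_inv
  tgt_inv := target_inv
  inv_comp := inv_comp
  comp_inv := comp_inv

theorem groupoidStr_isLie : A.groupoidStr.IsLie (E := A.arrows.model) (F := A.M.model) where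
  src_surjective x := ⟨unit A x, snd_unit A x⟩
  src_submersion := isSubmersion_snd
  tgt_surjective x := ⟨unit A x, target_unit A x⟩
  tgt_submersion := isSubmersion_target
  smooth_one := (unit A).smooth
  smooth_comp := by
    -- The additive formula is smooth on all pairs, so the submanifold of composable pairs needs no
    -- analysis.
    refine ContMDiff.contMDiffOn ?_
    exact (contMDiff_fst.sub ((unit A).smooth.comp ((snd A).smooth.comp contMDiff_fst))).add
      contMDiff_snd

/-- The action Lie group-groupoid `G ⋉ M`. -/
def actionGroupoid : LieGroupGroupoid.{u} where
  Arr := A.arrows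
  Obj := A.M
  toGroupoidStr := A.groupoidStr
  isLie := A.groupoidStr_isLie
  src_add := map_add (snd A)
  tgt_add := map_add (target A)
  interchange {b a d c} h h' := by
    have h1 : snd A b = target A a := h
    have h2 : snd A d = target A c := h'
    have h3 : snd A (b + d) = target A (a + c) := by rw [map_add, map_add, h1, h2]
    change comp b a + comp d c = comp (b + d) (a + c)
    -- The second coordinates add up directly; the first ones reduce to interchange in `G`.
    refine ext ?_ (by simp)
    rw [map_add, fst_comp h1, fst_comp h2, fst_comp h3, map_add, map_add,
      G.comp_add (src_fst_eq_tgt_fst h1) (src_fst_eq_tgt_fst h2)]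

/-- The projection `G ⋉ M ⟶ G`. -/
def actionGroupoidProj : A.actionGroupoid ⟶ G where
  arr := fst A
  obj := A.w
  src_arr := src_fst
  tgt_arr q := (w_target q).symm
  comp_arr h := fst_comp h

theorem isCovering_actionGroupoidProj : IsCovering A.actionGroupoidProj :=
  isDiffeoOn_fst

/-- The action Lie group-groupoid as a covering of `G`. -/
def actionCovering : LGGdCov G where
  total := A.actionGroupoid
  proj := A.actionGroupoidProj
  isCovering := A.isCovering_actionGroupoidProj

variable {A}

/-- The homomorphism `(a, x) ↦ (a, f x)` induced by a morphism of actions. -/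
def arrowsMap {B : LGGdOp G} (f : A ⟶ B) : LieHom A.arrows B.arrows where
  toFun q := arrows.mk (fst A q) (Hom.hom f (snd A q)) (by rw [src_fst, Hom.w_hom])
  map_zero' := ext (by simp) (by simp)
  map_add' p q := ext (by simp) (by simp)
  contMDiff_toFun := arrows.contMDiff (fst A).smooth ((Hom.hom f).smooth.comp (snd A).smooth)

@[simp] theorem fst_arrowsMap {B : LGGdOp G} (f : A ⟶ B) (q : A.arrows) :
    fst B (arrowsMap f q) = fst A q := rfl

@[simp] theorem snd_arrowsMap {B : LGGdOp G} (f : A ⟶ B) (q : A.arrows) :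
    snd B (arrowsMap f q) = Hom.hom f (snd A q) := rfl

theorem target_arrowsMap {B : LGGdOp G} (f : A ⟶ B) (q : A.arrows) :
    target B (arrowsMap f q) = Hom.hom f (target A q) :=
  (Hom.hom_act f (src_fst q)).symm

theorem arrowsMap_comp {B : LGGdOp G} (f : A ⟶ B) {q p : A.arrows} (h : snd A q = target A p) :
    arrowsMap f (comp q p) = comp (arrowsMap f q) (arrowsMap f p) := by
  have h' : snd B (arrowsMap f q) = target B (arrowsMap f p) := by
    rw [snd_arrowsMap, target_arrowsMap, h]
  refine ext ?_ (by simp)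
  rw [fst_comp h', fst_arrowsMap, fst_comp h, fst_arrowsMap, fst_arrowsMap]

/-- The morphism of coverings induced by a morphism of actions. -/
def actionCoveringMap {B : LGGdOp G} (f : A ⟶ B) : A.actionCovering ⟶ B.actionCovering where
  hom :=
    { arr := arrowsMap f
      obj := Hom.hom f
      src_arr := fun _ => rfl
      tgt_arr := target_arrowsMap f
      comp_arr := arrowsMap_comp f }
  w := LieGroupGroupoid.Hom.ext (LieHom.ext' fun _ => rfl)
    (LieHom.ext' fun x => (Hom.w_hom f x).symm)

end LGGdOp

/-- The functor that sends an action to its action Lie group-groupoid. -/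
def actionFunctor (G : LieGroupGroupoid.{u}) : LGGdOp G ⥤ LGGdCov G where
  obj A := A.actionCovering
  map f := LGGdOp.actionCoveringMap f
  map_id _ := rfl
  map_comp _ _ := rfl

/-! ### The two natural isomorphisms and the equivalence -/

section Equivalence

variable {G : LieGroupGroupoid.{u}}

namespace LGGdOp

open arrows

variable (A : LGGdOp G)

theorem lift_actionCovering {a : G.Arr} {x : A.M} (h : G.src a = A.w x) :
    A.actionCovering.lift a x = arrows.mk a x h :=
  A.actionCovering.lift_unique (snd_mk a x h) (fst_mk a x h)

/-- The two actions are compared only where `src a = w x`, since elsewhere their values carry no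
meaning. They are therefore related by an isomorphism over the identity of `M`, not by an equality
of structures. -/
theorem act_restrict_actionCovering {a : G.Arr} {x : A.M} (h : G.src a = A.w x) :
    A.actionCovering.restrict.act a x = A.act a x := by
  change target A (A.actionCovering.lift a x) = _
  rw [A.lift_actionCovering h, target_apply, fst_mk, snd_mk]

/-- The action on the objects of the action groupoid of `A` is `A`. -/
def restrictActionCoveringIso : A.actionCovering.restrict ≅ A where
  hom :=
    { hom := LieHom.id A.M
      w_hom := fun _ => rfl
      hom_act := fun h => A.act_restrict_actionCovering h }
  inv :=
    { hom := LieHom.id A.M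
      w_hom := fun _ => rfl
      hom_act := fun h => (A.act_restrict_actionCovering h).symm }
  hom_inv_id := rfl
  inv_hom_id := rfl

end LGGdOp

/-- The action functor followed by the restriction is isomorphic to the identity. -/
def actionRestrictionIso (G : LieGroupGroupoid.{u}) :
    actionFunctor G ⋙ restriction G ≅ 𝟭 (LGGdOp G) :=
  NatIso.ofComponents (fun A => A.restrictActionCoveringIso) fun _ => rfl

namespace LGGdCov

open LGGdOp.arrows

variable (P : LGGdCov G)

/-- The comparison `h ↦ (p h, src h)` on arrows. -/
def toArrows : LieHom P.total.Arr P.restrict.arrows where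
  toFun h := LGGdOp.arrows.mk (P.p h) (P.total.src h) (P.src_p h)
  map_zero' := LGGdOp.arrows.ext (map_zero P.p) (map_zero P.total.src)
  map_add' h k := LGGdOp.arrows.ext (map_add P.p h k) (map_add P.total.src h k)
  contMDiff_toFun := LGGdOp.arrows.contMDiff P.p.smooth P.total.smooth_src

@[simp] theorem fst_toArrows (h : P.total.Arr) : fst P.restrict (P.toArrows h) = P.p h := rfl

@[simp] theorem snd_toArrows (h : P.total.Arr) :
    snd P.restrict (P.toArrows h) = P.total.src h := rfl

theorem contMDiff_lift_comp {N : LieGrp.{u}} (f : LieHom N G.Arr) (g : LieHom N P.total.Obj)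
    (h : ∀ q, G.src (f q) = P.p₀ (g q)) :
    ContMDiff N.I P.total.Arr.I ∞ (fun q => P.lift (f q) (g q)) :=
  P.smooth_lift.comp_contMDiff (f.smooth.prodMk g.smooth) h

/-- The comparison `(a, x) ↦ s_p (a, x)` on arrows. -/
def ofArrows : LieHom P.restrict.arrows P.total.Arr where
  toFun q := P.lift (fst P.restrict q) (snd P.restrict q)
  map_zero' := P.lift_unique (map_zero P.total.src) (map_zero P.p)
  map_add' q q' := by
    rw [map_add, map_add]
    exact P.lift_add (src_fst q) (src_fst q')
  contMDiff_toFun := P.contMDiff_lift_comp (fst P.restrict) (snd P.restrict) src_fst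

theorem src_ofArrows (q : P.restrict.arrows) :
    P.total.src (P.ofArrows q) = snd P.restrict q := P.src_lift (src_fst q)

theorem p_ofArrows (q : P.restrict.arrows) : P.p (P.ofArrows q) = fst P.restrict q :=
  P.p_lift (src_fst q)

theorem tgt_ofArrows (q : P.restrict.arrows) :
    P.total.tgt (P.ofArrows q) = target P.restrict q := rfl

theorem ofArrows_toArrows (h : P.total.Arr) : P.ofArrows (P.toArrows h) = h :=
  P.lift_unique rfl rfl

theorem toArrows_ofArrows (q : P.restrict.arrows) : P.toArrows (P.ofArrows q) = q :=
  LGGdOp.arrows.ext (P.p_ofArrows q) (P.src_ofArrows q)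

theorem target_toArrows (h : P.total.Arr) : target P.restrict (P.toArrows h) = P.total.tgt h := by
  rw [← tgt_ofArrows, ofArrows_toArrows]

theorem toArrows_comp {b a : P.total.Arr} (h : P.total.src b = P.total.tgt a) :
    P.toArrows (P.total.comp b a) = comp (P.toArrows b) (P.toArrows a) := by
  refine LGGdOp.arrows.ext ?_ ?_
  · rw [fst_comp (by rw [target_toArrows, snd_toArrows, h]), fst_toArrows, P.p_comp h,
      fst_toArrows, fst_toArrows]
  · rw [snd_comp, snd_toArrows, P.total.src_comp h, snd_toArrows]

/-- The inverse of a bijection that preserves composition preserves it too. -/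
theorem ofArrows_comp {q q' : P.restrict.arrows}
    (h : snd P.restrict q = target P.restrict q') :
    P.ofArrows (comp q q') = P.total.comp (P.ofArrows q) (P.ofArrows q') := by
  have h' : P.total.src (P.ofArrows q) = P.total.tgt (P.ofArrows q') := by
    rw [src_ofArrows, tgt_ofArrows, h]
  rw [← P.ofArrows_toArrows (P.total.comp _ _), P.toArrows_comp h', toArrows_ofArrows,
    toArrows_ofArrows]

/-- A covering is isomorphic to the action groupoid of the action on its objects. -/
def isoActionCovering : P ≅ P.restrict.actionCovering where
  hom :=
    { hom :=
        { arr := P.toArrows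
          obj := LieHom.id P.total.Obj
          src_arr := P.snd_toArrows
          tgt_arr := P.target_toArrows
          comp_arr := P.toArrows_comp }
      w := rfl }
  inv :=
    { hom :=
        { arr := P.ofArrows
          obj := LieHom.id P.total.Obj
          src_arr := P.src_ofArrows
          tgt_arr := P.tgt_ofArrows
          comp_arr := P.ofArrows_comp }
      w := LieGroupGroupoid.Hom.ext (LieHom.ext' fun q => (P.p_ofArrows q).symm) rfl }
  hom_inv_id := Hom.ext (LieGroupGroupoid.Hom.ext (LieHom.ext' P.ofArrows_toArrows) rfl)
  inv_hom_id := Hom.ext (LieGroupGroupoid.Hom.ext (LieHom.ext' P.toArrows_ofArrows) rfl)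

end LGGdCov

theorem LGGdCov.Hom.p_arr {P Q : LGGdCov G} (r : P ⟶ Q) (h : P.total.Arr) :
    Q.p (LieGroupGroupoid.Hom.arr (LGGdCov.Hom.hom r) h) = P.p h := by
  rw [LGGdCov.p, LGGdCov.p, LGGdCov.Hom.w r]
  rfl

/-- The identity is isomorphic to the restriction followed by the action functor. -/
def restrictionActionIso (G : LieGroupGroupoid.{u}) :
    𝟭 (LGGdCov G) ≅ restriction G ⋙ actionFunctor G :=
  NatIso.ofComponents (fun P => P.isoActionCovering) fun r =>
    LGGdCov.Hom.ext (LieGroupGroupoid.Hom.ext (LieHom.ext' fun h =>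
      -- Naturality on arrows is checked on the coordinates `p` and `src`; on objects all maps are
      -- `r₀` itself.
      LGGdOp.arrows.ext (LGGdCov.Hom.p_arr r h)
        (LieGroupGroupoid.Hom.src_arr (LGGdCov.Hom.hom r) h)) rfl)

/-- The restriction functor is an equivalence, with the action functor as quasi-inverse. -/
def restrictionEquivalence (G : LieGroupGroupoid.{u}) : LGGdCov G ≌ LGGdOp G :=
  -- `Equivalence.mk` may alter the unit to obtain the triangle identity, but it keeps both
  -- functors.
  CategoryTheory.Equivalence.mk (restriction G) (actionFunctor G) (restrictionActionIso G)
    (actionRestrictionIso G)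

open Classical LGGdOp.arrows in
theorem isActionGroupoid_actionCovering (A : LGGdOp G) :
    IsActionGroupoid A A.actionCovering (fun x => x) where
  isDiffeo_obj := ⟨contMDiffOn_id, mapsTo_univ _ _, fun x => x, contMDiffOn_id, mapsTo_univ _ _,
    fun _ _ => rfl, fun _ _ => rfl⟩
  add_obj _ _ := rfl
  proj_obj _ := rfl
  isDiffeo_arr := by
    -- The inverse of the diffeomorphism onto the pullback; `0` off the pullback is junk.
    let g : G.Arr × A.M → A.arrows := fun q =>
      if h : G.src q.1 = A.w q.2 then LGGdOp.arrows.mk q.1 q.2 h else 0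
    have hg : ∀ {q} (h : G.src q.1 = A.w q.2), g q = LGGdOp.arrows.mk q.1 q.2 h :=
      fun h => dif_pos h
    refine ⟨((fst A).smooth.prodMk (snd A).smooth).contMDiffOn, fun q _ => src_fst q, g, ?_,
      mapsTo_univ _ _, fun q _ => hg (src_fst q), fun q hq => ?_⟩
    · refine LGGdOp.arrows.contMDiffOn (contMDiffOn_fst.congr fun q hq => ?_)
        (contMDiffOn_snd.congr fun q hq => ?_)
      · exact congrArg (fst A) (hg hq)
      · exact congrArg (snd A) (hg hq)
    · exact congrArg (fun r => (fst A r, snd A r)) (hg hq)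
  tgt_arr _ := rfl
  comp_arr h := Prod.ext (fst_comp h) (snd_comp _ _)
  add_arr _ _ := rfl

/-- An equivalence of categories that is compatible in both directions with properties of objects
restricts to the full subcategories. -/
def equivalenceFullSubcategory {C D : Type*} [Category* C] [Category* D] (e : C ≌ D)
    (P : ObjectProperty C) (Q : ObjectProperty D) (h : ∀ X, P X → Q (e.functor.obj X))
    (h' : ∀ Y, Q Y → P (e.inverse.obj Y)) : P.FullSubcategory ≌ Q.FullSubcategory where
  functor := Q.lift (P.ι ⋙ e.functor) fun X => h _ X.property
  inverse := P.lift (Q.ι ⋙ e.inverse) fun Y => h' _ Y.property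
  -- The inclusions are fully faithful, so unit and counit descend from the ambient categories.
  unitIso := (P.fullyFaithfulι.whiskeringRight _).preimageIso (P.ι.isoWhiskerLeft e.unitIso)
  counitIso := (Q.fullyFaithfulι.whiskeringRight _).preimageIso (Q.ι.isoWhiskerLeft e.counitIso)
  functor_unitIso_comp X := ObjectProperty.hom_ext _ (e.functor_unit_comp X.obj)

end Equivalence

end LieGG

end

theorem mainTheorem2 (G : LieGG.LieGroupGroupoid.{u}) :
    (∃ (Γ : LieGG.LGGdOp G ⥤ LieGG.LGGdCov G)
      (ε : Γ ⋙ LieGG.restriction G ≅ 𝟭 (LieGG.LGGdOp G)),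
      (∃ e : LieGG.LGGdCov G ≌ LieGG.LGGdOp G,
        e.functor = LieGG.restriction G ∧ e.inverse = Γ) ∧
      (∀ A : LieGG.LGGdOp G,
        LieGG.IsActionGroupoid A (Γ.obj A) (fun x => (LieGG.LGGdOp.Hom.hom (ε.hom.app A)) x)) ∧
      (∀ (A B : LieGG.LGGdOp G) (f : A ⟶ B),
        LieGG.IsActionGroupoidMap f (Γ.map f)
          (fun x => (LieGG.LGGdOp.Hom.hom (ε.hom.app A)) x)
          (fun x => (LieGG.LGGdOp.Hom.hom (ε.hom.app B)) x))) ∧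
    (∃ e : (LieGG.submersiveCov G).FullSubcategory ≌ (LieGG.submersiveOp G).FullSubcategory,
      Nonempty (e.functor ⋙ (LieGG.submersiveOp G).ι ≅
        (LieGG.submersiveCov G).ι ⋙ LieGG.restriction G)) :=
  ⟨⟨LieGG.actionFunctor G, LieGG.actionRestrictionIso G,
      ⟨LieGG.restrictionEquivalence G, rfl, rfl⟩,
      LieGG.isActionGroupoid_actionCovering, fun _ _ _ => ⟨fun _ => rfl, fun _ => rfl⟩⟩,
    -- Both functors keep the map on objects: `p₀` becomes `w` and `w` becomes `p₀`, so the two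
    -- submersion conditions are definitionally the same.
    LieGG.equivalenceFullSubcategory (LieGG.restrictionEquivalence G)
      (LieGG.submersiveCov G) (LieGG.submersiveOp G) (fun _ h => h) fun _ h => h, ⟨Iso.refl _⟩⟩
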